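/- All graphs are finite and simple. A real symmetric matrix $A$ is copositive if $x^TAx\ge 0$ for every entrywise nonnegative vector $x$, and it is SPN if it is the sum of a real positive semidefinite matrix and a symmetric entrywise nonnegative matrix. The graph $G(A)$ of a symmetric matrix $A$ has as its vertices the row indices of $A$, and distinct $i,j$ are adjacent if and only if $a_{ij}\ne 0$. A graph $G$ is an SPN graph if every copositive matrix $A$ with $G(A)=G$ is SPN. A subdivision of a graph $H$ is a graph obtained from $H$ by replacing every edge $ab$ by a path of length at least $1$ from $a$ to $b$, where the inner vertices of these paths are new vertices and no two of the paths share an inner vertex; an edge is said to be subdivided if its path has length at least $2$ (possibly no edge is subdivided). Let $F_5$ be the fan consisting of a path on four vertices and a fifth vertex adjacent to all four of them, let $CD_6$ be the graph with vertices $1,\dots,6$ and edges $12,13,23,25,34,45,46,56$ (two disjoint triangles joined by two disjoint edges), and let $K_4$ be the complete graph on four vertices. Theorem. Let $G$ be an SPN graph. Then no (not necessarily induced) subgraph of $G$ is isomorphic to any of the following: (1) a subdivision of $F_5$; (2) a subdivision of $CD_6$; (3) a subdivision of $K_4$ in which at least two and at most five of the six edges are subdivided, each at least once. -/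

import Mathlib

/-- A real symmetric matrix `A` is copositive if `xᵀ A x ≥ 0` for every nonnegative vector `x`. -/
def IsCopositive {V : Type*} [Fintype V] (A : Matrix V V ℝ) : Prop :=
  A.IsSymm ∧ ∀ x : V → ℝ, (∀ i, 0 ≤ x i) → 0 ≤ x ⬝ᵥ (A.mulVec x)

/-- A matrix is SPN if it is the sum of a real positive semidefinite matrix and a symmetric
entrywise nonnegative one. -/
def IsSPN {V : Type*} [Fintype V] (A : Matrix V V ℝ) : Prop :=
  ∃ P N : Matrix V V ℝ, P.PosSemidef ∧ N.IsSymm ∧ (∀ i j, 0 ≤ N i j) ∧ A = P + N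

/-- The graph of a symmetric matrix: distinct `i` and `j` are adjacent iff the `(i, j)` entry is
nonzero. (For a matrix that is not symmetric the relation is symmetrized.) -/
def matrixGraph {V : Type*} (A : Matrix V V ℝ) : SimpleGraph V :=
  SimpleGraph.fromRel fun i j => A i j ≠ 0

/-- A finite graph `G` is an SPN graph if every copositive matrix whose graph is `G` is SPN. -/
def IsSPNGraph {V : Type*} [Fintype V] (G : SimpleGraph V) : Prop :=
  ∀ A : Matrix V V ℝ, IsCopositive A → matrixGraph A = G → IsSPN A

/-- A presentation of the graph `K` as a subdivision of the graph `H`: every edge of `H` is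
replaced by a path of `K` (of length at least one) between the corresponding vertices, the inner
vertices of these paths are new and not shared by different paths, and `K` has no other vertices
and edges. -/
structure Subdivision {W U : Type*} (H : SimpleGraph W) (K : SimpleGraph U) where
  /-- The vertex of `K` corresponding to a vertex of `H`. -/
  branch : W → U
  branch_injective : Function.Injective branch
  /-- The path of `K` replacing the edge `ab` of `H`, traversed from `a` to `b`. -/
  path : ∀ {a b : W}, H.Adj a b → K.Walk (branch a) (branch b)
  path_symm : ∀ {a b : W} (h : H.Adj a b), path h.symm = (path h).reverse
  isPath : ∀ {a b : W} (h : H.Adj a b), (path h).IsPath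
  /-- The inner vertices of the paths are not vertices of `H`. -/
  inner_new : ∀ {a b : W} (h : H.Adj a b) (w : W),
    branch w ∈ (path h).support → w = a ∨ w = b
  /-- The paths replacing two different edges have no inner vertices in common. -/
  independent : ∀ {a b c d : W} (h : H.Adj a b) (h' : H.Adj c d), s(a, b) ≠ s(c, d) →
    ∀ u : U, u ∈ (path h).support → u ∈ (path h').support → u ∈ Set.range branch
  cover_vertex : ∀ u : U, u ∈ Set.range branch ∨
    ∃ (a b : W) (h : H.Adj a b), u ∈ (path h).support
  cover_edge : ∀ e ∈ K.edgeSet, ∃ (a b : W) (h : H.Adj a b), e ∈ (path h).edges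

/-- The edges of `H` that are actually subdivided (at least once), i.e. that are replaced by a path
of length at least two. -/
def Subdivision.subdividedEdges {W U : Type*} {H : SimpleGraph W} {K : SimpleGraph U}
    (s : Subdivision H K) : Set (Sym2 W) :=
  {e | ∃ (a b : W) (h : H.Adj a b), e = s(a, b) ∧ 2 ≤ (s.path h).length}

/-- `K` is a subdivision of `H`. Any graph is a subdivision of itself. -/
def IsSubdivision {W U : Type*} (H : SimpleGraph W) (K : SimpleGraph U) : Prop :=
  Nonempty (Subdivision H K)

/-- The fan `F₅`: the path `0 - 1 - 2 - 3` and a further vertex `4` adjacent to all four vertices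
of the path. -/
def fanGraph5 : SimpleGraph (Fin 5) :=
  SimpleGraph.fromEdgeSet {s(0, 1), s(1, 2), s(2, 3), s(4, 0), s(4, 1), s(4, 2), s(4, 3)}

/-- The graph `CD₆`: the cycle `0 - 2 - 3 - 5 - 4 - 1 - 0` with the two chords `12` and `34`, that
is, the triangles `012` and `345` joined by the disjoint edges `23` and `14`. -/
def graphCD6 : SimpleGraph (Fin 6) :=
  SimpleGraph.fromEdgeSet
    {s(0, 2), s(2, 3), s(3, 5), s(5, 4), s(4, 1), s(1, 0), s(1, 2), s(3, 4)}

/-! All three kinds of subdivision contain the fan $F_5$ as a minor, and a graph with an $F_5$ minor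
is not SPN.

Non-SPN is certified by weak duality: an SPN matrix pairs nonnegatively with every doubly
nonnegative matrix. `fanMatrix` is copositive with support in $F_5$ and pairs to $-2$ with the Gram
matrix of `fanCertificate`.

To lift this along a minor, place each entry of `fanMatrix` on an edge of $G$ between the
corresponding fibres (diagonal entries inside a fibre) and add $\varepsilon I + M L$, where $L$ is
the Laplacian of the edges inside the fibres. Vectors in the kernel of $L$ are constant on each
connected fibre, so the form there is the fan form plus $\varepsilon|x|^2$, positive for $x \ge 0$,
$x \ne 0$; a compactness argument then gives copositivity for large $M$. The certificate, extended
constantly over fibres, does not see $L$, so its pairing stays negative for small $\varepsilon$.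

The combinatorial half is `Subdivision.hasMinor`, which reduces a minor of a subdivision to a finite
check on the original graph. -/

section

open Matrix Finset Filter Topology

/-! ### Duality certificates and penalised copositivity -/

/-- The pairing of an SPN matrix with a doubly nonnegative matrix `∑ k, v k (v k)ᵀ` is
nonnegative. -/
theorem IsSPN.sum_dotProduct_mulVec_nonneg {V ι : Type*} [Fintype V] [Fintype ι]
    {A : Matrix V V ℝ} (hA : IsSPN A) (v : ι → V → ℝ)
    (hv : ∀ i j, 0 ≤ ∑ k, v k i * v k j) : 0 ≤ ∑ k, v k ⬝ᵥ A *ᵥ v k := by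
  obtain ⟨P, N, hP, -, hN, rfl⟩ := hA
  have hNv : ∑ k, v k ⬝ᵥ N *ᵥ v k = ∑ i, ∑ j, N i j * ∑ k, v k i * v k j := by
    simp only [dotProduct, mulVec, mul_sum]
    rw [sum_comm]
    refine sum_congr rfl fun i _ => ?_
    rw [sum_comm]
    exact sum_congr rfl fun j _ => sum_congr rfl fun k _ => by ring
  simp only [add_mulVec, dotProduct_add, sum_add_distrib]
  refine add_nonneg (sum_nonneg fun k _ => ?_) ?_
  · simpa using hP.dotProduct_mulVec_nonneg (v k)
  · rw [hNv]
    exact sum_nonneg fun i _ => sum_nonneg fun j _ => mul_nonneg (hN i j) (hv i j)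

/-- A graph is not SPN if some copositive matrix whose off-diagonal support is contained in its
edge set pairs negatively with a doubly nonnegative matrix. -/
theorem not_isSPNGraph_of_certificate {V ι : Type*} [Fintype V] [Fintype ι] {G : SimpleGraph V}
    {A : Matrix V V ℝ} (hA : IsCopositive A) (hG : ∀ i j, i ≠ j → A i j ≠ 0 → G.Adj i j)
    (v : ι → V → ℝ) (hv : ∀ i j, 0 ≤ ∑ k, v k i * v k j)
    (hneg : ∑ k, v k ⬝ᵥ A *ᵥ v k < 0) : ¬ IsSPNGraph G := by
  classical
  intro h
  set J := G.adjMatrix ℝ with hJ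
  have hform : ∀ (t : ℝ) (x : V → ℝ),
      x ⬝ᵥ (A + t • J) *ᵥ x = x ⬝ᵥ A *ᵥ x + t * (x ⬝ᵥ J *ᵥ x) := fun t x => by
    simp [add_mulVec, smul_mulVec, dotProduct_add, dotProduct_smul]
  -- A small positive multiple of the adjacency matrix turns containment of supports into equality:
  -- only finitely many $t$ cancel an entry, copositivity is kept since the added matrix is
  -- nonnegative, and the strict inequality persists by continuity.
  have hne : ∀ᶠ t : ℝ in 𝓝[>] 0, ∀ i j, A i j + t ≠ 0 := by
    refine eventually_all.2 fun i => eventually_all.2 fun j => ?_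
    by_cases hij : A i j = 0
    · filter_upwards [self_mem_nhdsWithin] with t ht
      simpa [hij] using (ne_of_gt ht)
    · refine Filter.Eventually.filter_mono nhdsWithin_le_nhds ?_
      have : Tendsto (fun t : ℝ => A i j + t) (𝓝 0) (𝓝 (A i j + 0)) :=
        tendsto_const_nhds.add tendsto_id
      exact this.eventually_ne (by simpa using hij)
  have hlt : ∀ᶠ t : ℝ in 𝓝[>] 0, ∑ k, v k ⬝ᵥ (A + t • J) *ᵥ v k < 0 := by
    refine Filter.Eventually.filter_mono nhdsWithin_le_nhds ?_
    simp only [hform, sum_add_distrib, ← mul_sum]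
    have : Tendsto (fun t : ℝ => ∑ k, v k ⬝ᵥ A *ᵥ v k + t * ∑ k, v k ⬝ᵥ J *ᵥ v k) (𝓝 0)
        (𝓝 (∑ k, v k ⬝ᵥ A *ᵥ v k + 0 * ∑ k, v k ⬝ᵥ J *ᵥ v k)) :=
      tendsto_const_nhds.add (tendsto_id.mul tendsto_const_nhds)
    exact this.eventually_lt_const (by simpa using hneg)
  obtain ⟨t, ⟨htne, htlt⟩, ht⟩ := ((hne.and hlt).and self_mem_nhdsWithin).exists
  have ht : 0 < t := ht
  have hcop : IsCopositive (A + t • J) := by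
    refine ⟨hA.1.add ((G.isSymm_adjMatrix).smul t), fun x hx => ?_⟩
    rw [hform]
    refine add_nonneg (hA.2 x hx) (mul_nonneg ht.le ?_)
    refine sum_nonneg fun i _ => mul_nonneg (hx i) (sum_nonneg fun j _ => mul_nonneg ?_ (hx j))
    change 0 ≤ J i j
    rw [hJ, SimpleGraph.adjMatrix_apply]
    split_ifs <;> simp
  have hgraph : matrixGraph (A + t • J) = G := by
    ext i j
    rw [matrixGraph, SimpleGraph.fromRel_adj]
    by_cases hij : G.Adj i j
    · simp [hJ, hij, hij.ne, hij.symm, htne]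
    · have hji : ¬ G.Adj j i := fun h' => hij h'.symm
      have h1 : i ≠ j → A i j = 0 := fun hn => by_contra fun h0 => hij (hG i j hn h0)
      have h2 : i ≠ j → A j i = 0 := fun hn => by_contra fun h0 => hji (hG j i hn.symm h0)
      simp only [hJ, hij, hji, Matrix.add_apply, Matrix.smul_apply, SimpleGraph.adjMatrix_apply, if_false,
        smul_zero, add_zero, iff_false, not_and, not_or, not_not]
      exact fun hn => ⟨h1 hn, h2 hn⟩
  exact absurd ((h _ hcop hgraph).sum_dotProduct_mulVec_nonneg v hv) (not_le.2 htlt)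

/-- If `B` is strictly copositive on the kernel of the positive semidefinite form `L`, then
`B + M L` is copositive for all large `M`. -/
theorem exists_nonneg_add_smul {V : Type*} [Fintype V] (B L : Matrix V V ℝ)
    (hL : ∀ x, 0 ≤ x ⬝ᵥ L *ᵥ x)
    (hB : ∀ x : V → ℝ, (∀ i, 0 ≤ x i) → x ≠ 0 → x ⬝ᵥ L *ᵥ x = 0 → 0 < x ⬝ᵥ B *ᵥ x) :
    ∃ M : ℝ, ∀ x : V → ℝ, (∀ i, 0 ≤ x i) → 0 ≤ x ⬝ᵥ (B + M • L) *ᵥ x := by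
  have hform : ∀ (t : ℝ) (x : V → ℝ),
      x ⬝ᵥ (B + t • L) *ᵥ x = x ⬝ᵥ B *ᵥ x + t * (x ⬝ᵥ L *ᵥ x) := fun t x => by
    simp [add_mulVec, smul_mulVec, dotProduct_add, dotProduct_smul]
  let U : ℕ → Set (V → ℝ) := fun n => {x | 0 < x ⬝ᵥ (B + (n : ℝ) • L) *ᵥ x}
  have hU : ∀ n, IsOpen (U n) := fun n => by
    refine isOpen_lt continuous_const ?_
    simp only [dotProduct, mulVec]
    fun_prop
  have hmono : Monotone U := fun m n hmn x hx => by
    have hx : 0 < x ⬝ᵥ (B + (m : ℝ) • L) *ᵥ x := hx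
    change 0 < x ⬝ᵥ (B + (n : ℝ) • L) *ᵥ x
    rw [hform] at hx ⊢
    have : (m : ℝ) ≤ n := by exact_mod_cast hmn
    nlinarith [mul_le_mul_of_nonneg_right this (hL x)]
  have hcover : stdSimplex ℝ V ⊆ ⋃ n, U n := fun x hx => by
    have hx0 : x ≠ 0 := by
      rintro rfl
      simpa using hx.2
    rw [Set.mem_iUnion]
    rcases (hL x).eq_or_lt with h0 | h0
    · refine ⟨0, ?_⟩
      change 0 < x ⬝ᵥ (B + ((0 : ℕ) : ℝ) • L) *ᵥ x
      rw [hform]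
      simpa using hB x hx.1 hx0 h0.symm
    · obtain ⟨n, hn⟩ := exists_nat_gt (-(x ⬝ᵥ B *ᵥ x) / (x ⬝ᵥ L *ᵥ x))
      refine ⟨n, ?_⟩
      change 0 < x ⬝ᵥ (B + (n : ℝ) • L) *ᵥ x
      rw [hform]
      rw [div_lt_iff₀ h0] at hn
      linarith
  -- The open sets `U n` increase with `n` because `L` is nonnegative, so compactness of the simplex
  -- yields a single `n`; homogeneity then extends the bound to the whole orthant.
  obtain ⟨n, hn⟩ := (isCompact_stdSimplex ℝ V).elim_directed_cover U hU hcover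
    (directed_of_isDirected_le hmono)
  refine ⟨n, fun x hx => ?_⟩
  rcases (sum_nonneg fun i (_ : i ∈ univ) => hx i).eq_or_lt with h0 | h0
  · have : x = 0 := funext fun i =>
      (sum_eq_zero_iff_of_nonneg fun i _ => hx i).1 h0.symm i (mem_univ i)
    simp [this]
  · set c := ∑ i, x i with hc
    have hmem : c⁻¹ • x ∈ stdSimplex ℝ V := by
      refine ⟨fun i => mul_nonneg (inv_nonneg.2 h0.le) (hx i), ?_⟩
      simp only [Pi.smul_apply, smul_eq_mul, ← mul_sum, ← hc]
      exact inv_mul_cancel₀ h0.ne'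
    have hpos : 0 < (c⁻¹ • x) ⬝ᵥ (B + (n : ℝ) • L) *ᵥ (c⁻¹ • x) := hn hmem
    rw [mulVec_smul, dotProduct_smul, smul_dotProduct, smul_eq_mul, smul_eq_mul] at hpos
    have hc' : 0 < c⁻¹ := inv_pos.2 h0
    exact (pos_of_mul_pos_right (pos_of_mul_pos_right hpos hc'.le) hc'.le).le

/-! ### The fan matrix and its certificate -/

/-- A copositive matrix supported on the fan `F₅` that is not SPN. -/
def fanMatrix : Matrix (Fin 5) (Fin 5) ℝ :=
  !![1, -1, 0, 0, 1;
     -1, 1, 1, 0, -1;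
     0, 1, 1, -1, -1;
     0, 0, -1, 1, 1;
     1, -1, -1, 1, 1]

theorem fanMatrix_comm (i j : Fin 5) : fanMatrix i j = fanMatrix j i := by
  fin_cases i <;> fin_cases j <;> rfl

theorem fanMatrix_ne_zero {i j : Fin 5} (hij : i ≠ j) (h : fanMatrix i j ≠ 0) :
    fanGraph5.Adj i j := by
  fin_cases i <;> fin_cases j <;> simp_all [fanMatrix, fanGraph5]

/-- With $s = a-b+e-c+d$, the form equals $s^2 + 2ac + 2d(b-a)$ and also $s^2 + 2bd + 2a(c-d)$,
which settles $a \le b$ and $d \le c$. Otherwise it is $(a-b)^2 + (d-c)^2 + e^2 + 2bc + 2e(a-b) +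
2e(d-c)$, with every term nonnegative. -/
theorem fanMatrix_form_nonneg (y : Fin 5 → ℝ) (hy : ∀ i, 0 ≤ y i) :
    0 ≤ ∑ i, ∑ j, fanMatrix i j * (y i * y j) := by
  simp only [fanMatrix, Fin.sum_univ_five, of_apply, cons_val', cons_val_zero, cons_val_one,
    Matrix.cons_val, cons_val_fin_one]
  have h0 := hy 0
  have h1 := hy 1
  have h2 := hy 2
  have h3 := hy 3
  have h4 := hy 4
  generalize y 0 = a, y 1 = b, y 2 = c, y 3 = d, y 4 = e at *
  rcases le_total a b with hab | hab
  · nlinarith [sq_nonneg (a - b + e - c + d), mul_nonneg h0 h2, mul_nonneg (sub_nonneg.2 hab) h3]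
  rcases le_total d c with hdc | hdc
  · nlinarith [sq_nonneg (a - b + e - c + d), mul_nonneg h1 h3, mul_nonneg (sub_nonneg.2 hdc) h0]
  · nlinarith [sq_nonneg (a - b), sq_nonneg (d - c), sq_nonneg e, mul_nonneg h1 h2,
      mul_nonneg h4 (sub_nonneg.2 hab), mul_nonneg h4 (sub_nonneg.2 hdc)]

/-- The factors of a doubly nonnegative matrix that pairs negatively with `fanMatrix`. -/
def fanCertificate : Fin 4 → Fin 5 → ℝ :=
  -- The first two vectors are nonnegative zeros of the fan form; the third has value $-1$. Taken
  -- twice, its negative products at positions $(0,4)$ and $(3,4)$ are cancelled exactly by the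
  -- first two vectors.
  ![![2, 3, 0, 0, 1], ![0, 0, 3, 2, 1], ![-1, 0, 0, -1, 1], ![-1, 0, 0, -1, 1]]

theorem fanCertificate_gram_nonneg (i j : Fin 5) :
    0 ≤ ∑ k, fanCertificate k i * fanCertificate k j := by
  fin_cases i <;> fin_cases j <;>
    simp [fanCertificate, Fin.sum_univ_four] <;> norm_num

theorem fanCertificate_pairing :
    ∑ k, ∑ i, ∑ j, fanMatrix i j * (fanCertificate k i * fanCertificate k j) = -2 := by
  simp [fanMatrix, fanCertificate, Fin.sum_univ_four, Fin.sum_univ_five]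
  norm_num

/-! ### Minors and lifting the fan matrix -/

/-- The subgraph of `G` formed by the edges inside the fibres of `f`. -/
def SimpleGraph.fiberGraph {V C : Type*} (G : SimpleGraph V) (f : V → C) : SimpleGraph V where
  Adj v w := G.Adj v w ∧ f v = f w
  symm := ⟨fun _ _ h => ⟨h.1.symm, h.2.symm⟩⟩
  loopless := ⟨fun _ h => h.1.ne rfl⟩

/-- `H` is a minor of `G`: there are disjoint connected sets of vertices of `G`, the fibres of a
partial function to the vertices of `H`, with an edge of `G` between them for every edge of `H`. -/
def SimpleGraph.HasMinor {V C : Type*} (G : SimpleGraph V) (H : SimpleGraph C) : Prop :=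
  ∃ f : V → Option C,
    (∀ v w i, f v = some i → f w = some i → (G.fiberGraph f).Reachable v w) ∧
    ∀ i j, H.Adj i j → ∃ v w, G.Adj v w ∧ f v = some i ∧ f w = some j

/-- A minor of a subgraph is a minor of the graph. -/
theorem SimpleGraph.HasMinor.of_coe {V C : Type*} {G : SimpleGraph V} {H : SimpleGraph C}
    {S : G.Subgraph} (h : S.coe.HasMinor H) : G.HasMinor H := by
  classical
  obtain ⟨f, hconn, hadj⟩ := h
  have hf : ∀ v : S.verts, (fun v => if hv : v ∈ S.verts then f ⟨v, hv⟩ else none) v.1 = f v :=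
    fun v => dif_pos v.2
  refine ⟨fun v => if hv : v ∈ S.verts then f ⟨v, hv⟩ else none, fun v w i hv hw => ?_,
    fun i j hij => ?_⟩
  · have hvS : v ∈ S.verts := by
      by_contra h0
      simp [h0] at hv
    have hwS : w ∈ S.verts := by
      by_contra h0
      simp [h0] at hw
    let φ : S.coe.fiberGraph f →g G.fiberGraph
        (fun v => if hv : v ∈ S.verts then f ⟨v, hv⟩ else none) :=
      ⟨Subtype.val, fun {a b} hab =>
        ⟨S.adj_sub hab.1, (hf a).trans (hab.2.trans (hf b).symm)⟩⟩
    exact (hconn ⟨v, hvS⟩ ⟨w, hwS⟩ i ((hf ⟨v, hvS⟩).symm.trans hv)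
      ((hf ⟨w, hwS⟩).symm.trans hw)).map φ
  · obtain ⟨v, w, hvw, hv, hw⟩ := hadj i j hij
    exact ⟨v, w, S.adj_sub hvw, (hf v).trans hv, (hf w).trans hw⟩

/-- A graph with the fan `F₅` as a minor is not an SPN graph. -/
theorem not_isSPNGraph_of_hasMinor_fan {V : Type*} [Fintype V] {G : SimpleGraph V}
    (hG : G.HasMinor fanGraph5) : ¬ IsSPNGraph G := by
  classical
  obtain ⟨f, hconn, hadj⟩ := hG
  have hex : ∀ i, ∃ v, f v = some i := fun i => by
    have : ∃ j, fanGraph5.Adj i j := by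
      fin_cases i
      · exact ⟨1, by simp [fanGraph5]⟩
      · exact ⟨2, by simp [fanGraph5]⟩
      · exact ⟨3, by simp [fanGraph5]⟩
      · exact ⟨4, by simp [fanGraph5]⟩
      · exact ⟨0, by simp [fanGraph5]⟩
    obtain ⟨j, hj⟩ := this
    obtain ⟨v, -, -, hv, -⟩ := hadj i j hj
    exact ⟨v, hv⟩
  -- `u i j` is the end in fibre `i` of a chosen edge to fibre `j`. The comparison `i < j` makes
  -- both orders use the same edge; for non-adjacent pairs, including the diagonal, any vertex of
  -- the fibre serves.
  have hu : ∃ u : Fin 5 → Fin 5 → V, (∀ i j, f (u i j) = some i) ∧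
      ∀ i j, fanGraph5.Adj i j → G.Adj (u i j) (u j i) := by
    choose r hr using hex
    choose s t hst hs ht using hadj
    refine ⟨fun i j => if h : fanGraph5.Adj i j then
      (if i < j then s i j h else t j i h.symm) else r i, fun i j => ?_, fun i j h => ?_⟩
    · by_cases h : fanGraph5.Adj i j
      · by_cases hlt : i < j <;> simp [h, hlt, hs, ht]
      · simp [h, hr]
    · rcases h.ne.lt_or_gt with hlt | hlt
      · simpa [h, h.symm, hlt, hlt.not_gt] using hst i j h
      · simpa [h, h.symm, hlt, hlt.not_gt] using (hst j i h.symm).symm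
  obtain ⟨u, huf, hua⟩ := hu
  set K := G.fiberGraph f with hK
  let L : Matrix V V ℝ := K.lapMatrix ℝ
  let B₀ : Matrix V V ℝ := ∑ i, ∑ j, Matrix.single (u i j) (u j i) (fanMatrix i j)
  have hB₀ : ∀ x : V → ℝ, x ⬝ᵥ B₀ *ᵥ x
      = ∑ i, ∑ j, fanMatrix i j * (x (u i j) * x (u j i)) := fun x => by
    simp only [B₀, Matrix.sum_mulVec, dotProduct_sum, Matrix.single_mulVec]
    refine Finset.sum_congr rfl fun i _ => Finset.sum_congr rfl fun j _ => ?_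
    rw [dotProduct_comm]
    simp [Function.update_apply, dotProduct]
    ring
  have hB₀s : B₀.IsSymm := by
    change B₀ᵀ = B₀
    simp only [B₀, Matrix.transpose_sum, Matrix.transpose_single]
    rw [Finset.sum_comm]
    exact Finset.sum_congr rfl fun i _ => Finset.sum_congr rfl fun j _ => by
      rw [fanMatrix_comm]
  have hB₀G : ∀ v w, v ≠ w → ¬ G.Adj v w → B₀ v w = 0 := fun v w hvw hn => by
    simp only [B₀, Matrix.sum_apply]
    refine Finset.sum_eq_zero fun i _ => Finset.sum_eq_zero fun j _ => ?_
    rw [Matrix.single_apply]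
    refine ite_eq_right_iff.2 fun h => ?_
    obtain ⟨rfl, rfl⟩ := h
    by_contra h0
    exact hn (hua i j (fanMatrix_ne_zero (fun hij => hvw (by rw [hij])) h0))
  have hLnn : ∀ x, 0 ≤ x ⬝ᵥ L *ᵥ x := fun x => by
    simpa using (SimpleGraph.posSemidef_lapMatrix ℝ K).dotProduct_mulVec_nonneg x
  have hLzero : ∀ x : V → ℝ, x ⬝ᵥ L *ᵥ x = 0 ↔ ∀ v w, K.Reachable v w → x v = x w := fun x => by
    rw [← K.lapMatrix_toLinearMap₂'_apply'_eq_zero_iff_forall_reachable x,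
      Matrix.toLinearMap₂'_apply']
  have hLG : ∀ v w, v ≠ w → ¬ G.Adj v w → L v w = 0 := fun v w hvw hn => by
    have : ¬ K.Adj v w := fun h => hn h.1
    simp [L, SimpleGraph.lapMatrix, SimpleGraph.degMatrix, hvw, this]
  -- Constant on fibres of `f`, with value 0 off the minor, so the Laplacian form vanishes on it.
  let p : Fin 4 → V → ℝ := fun k v => (f v).elim 0 (fanCertificate k)
  have hp : ∀ v w, 0 ≤ ∑ k, p k v * p k w := fun v w => by
    simp only [p]
    rcases hv : f v with _ | i
    · simp
    · rcases hw : f w with _ | j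
      · simp
      · exact fanCertificate_gram_nonneg i j
  have hpu : ∀ k i j, p k (u i j) = fanCertificate k i := fun k i j => by simp [p, huf]
  have hpB : ∑ k, p k ⬝ᵥ B₀ *ᵥ p k = -2 := by
    simp only [hB₀, hpu]
    exact fanCertificate_pairing
  have hpL : ∀ k, p k ⬝ᵥ L *ᵥ p k = 0 := fun k => by
    rw [hLzero]
    rintro v w ⟨q⟩
    induction q with
    | nil => rfl
    | cons h _ ih => exact Eq.trans (by simp only [p, h.2]) ih
  obtain ⟨ε, hε, hεp⟩ : ∃ ε : ℝ, 0 < ε ∧ ε * ∑ k, p k ⬝ᵥ p k < 2 := by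
    set c := ∑ k, p k ⬝ᵥ p k
    have hc : 0 ≤ c := Finset.sum_nonneg fun k _ =>
      Finset.sum_nonneg fun v _ => mul_self_nonneg _
    refine ⟨1 / (c + 1), by positivity, ?_⟩
    rw [div_mul_eq_mul_div, div_lt_iff₀ (by positivity)]
    linarith
  have hBform : ∀ x : V → ℝ, x ⬝ᵥ (B₀ + ε • (1 : Matrix V V ℝ)) *ᵥ x
      = x ⬝ᵥ B₀ *ᵥ x + ε * (x ⬝ᵥ x) := fun x => by
    simp [add_mulVec, smul_mulVec, dotProduct_add, dotProduct_smul]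
  obtain ⟨M, hM⟩ := exists_nonneg_add_smul (B₀ + ε • (1 : Matrix V V ℝ)) L hLnn
    fun x hx hx0 hxL => by
      rw [hLzero] at hxL
      have hxu : ∀ i j, x (u i j) = x (u i i) := fun i j =>
        hxL _ _ (hconn _ _ i (huf i j) (huf i i))
      have h1 : 0 ≤ x ⬝ᵥ B₀ *ᵥ x := by
        rw [hB₀]
        refine (fanMatrix_form_nonneg (fun i => x (u i i)) fun i => hx _).trans_eq ?_
        exact Finset.sum_congr rfl fun i _ => Finset.sum_congr rfl fun j _ => by
          rw [hxu i j, hxu j i]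
      have h2 : 0 < x ⬝ᵥ x := by simpa using dotProduct_star_self_pos_iff.2 hx0
      rw [hBform]
      positivity
  refine not_isSPNGraph_of_certificate (A := B₀ + ε • (1 : Matrix V V ℝ) + M • L)
    ⟨?_, hM⟩ (fun v w hvw h0 => ?_) p hp ?_
  · exact (hB₀s.add (isSymm_one.smul ε)).add ((SimpleGraph.isSymm_lapMatrix ℝ K).smul M)
  · by_contra hn
    exact h0 (by simp [hB₀G v w hvw hn, hLG v w hvw hn, hvw])
  · have : ∀ k, p k ⬝ᵥ (B₀ + ε • (1 : Matrix V V ℝ) + M • L) *ᵥ p k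
        = p k ⬝ᵥ B₀ *ᵥ p k + ε * (p k ⬝ᵥ p k) := fun k => by
      rw [add_mulVec, dotProduct_add, hBform, smul_mulVec, dotProduct_smul, hpL k]
      simp
    simp only [this, Finset.sum_add_distrib, ← Finset.mul_sum, hpB]
    linarith

end

/-! ### Walks and paths relative to fibres -/

namespace SimpleGraph

variable {V C : Type*} {G : SimpleGraph V} {f : V → C}

/-- A walk inside a fibre connects its endpoints in the fibre graph. -/
theorem Walk.reachable_fiberGraph {v w : V} (p : G.Walk v w) {c : C}
    (hp : ∀ u ∈ p.support, f u = c) : (G.fiberGraph f).Reachable v w := by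
  induction p with
  | nil => exact Reachable.refl _
  | @cons a b d h p ih =>
    have hb : f b = c := hp b (by simp)
    have hab : (G.fiberGraph f).Adj a b := ⟨h, (hp a (by simp)).trans hb.symm⟩
    exact hab.reachable.trans (ih fun u hu => hp u (by simp [hu]))

/-- A walk from one fibre to another one that meets no third fibre uses an edge between the two. -/
theorem Walk.exists_adj_fiber {v w : V} (p : G.Walk v w) {c d : C} (hcd : c ≠ d)
    (hv : f v = c) (hw : f w = d) (hp : ∀ u ∈ p.support, f u = c ∨ f u = d) :
    ∃ x y, G.Adj x y ∧ f x = c ∧ f y = d := by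
  induction p with
  | nil => exact absurd (hv.symm.trans hw) hcd
  | @cons a b e h p ih =>
    rcases hp b (by simp) with hb | hb
    · exact ih hb hw fun u hu => hp u (by simp [hu])
    · exact ⟨a, b, h, hv, hb⟩

/-- The start of a path is connected in the fibre graph to every vertex other than the end if all
these vertices lie in one fibre. -/
theorem Walk.IsPath.reachable_fiberGraph_start {v w u : V} {p : G.Walk v w} (hp : p.IsPath) {c : C}
    (h : ∀ x ∈ p.support, x ≠ w → f x = c) (hu : u ∈ p.support) (huw : u ≠ w) :
    (G.fiberGraph f).Reachable v u := by
  classical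
  refine (p.takeUntil u hu).reachable_fiberGraph (c := c) fun x hx =>
    h x (p.support_takeUntil_subset_support hu hx) ?_
  rintro rfl
  exact Walk.endpoint_notMem_support_takeUntil hp hu huw.symm hx

/-- Any two inner vertices of a path are connected in the fibre graph if all inner vertices lie in
one fibre. -/
theorem Walk.IsPath.reachable_fiberGraph_inner {v w x y : V} {p : G.Walk v w} (hp : p.IsPath)
    {c : C} (h : ∀ u ∈ p.support, u ≠ v → u ≠ w → f u = c) (hx : x ∈ p.support) (hxv : x ≠ v)
    (hxw : x ≠ w) (hy : y ∈ p.support) (hyv : y ≠ v) (hyw : y ≠ w) :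
    (G.fiberGraph f).Reachable x y := by
  cases p with
  | nil => simp_all
  | @cons _ b _ hadj q =>
    rw [Walk.cons_isPath_iff] at hp
    have hq : ∀ u ∈ q.support, u ≠ w → f u = c := fun u hu huw =>
      h u (by simp [hu]) (fun huv => hp.2 (huv ▸ hu)) huw
    have hx' : x ∈ q.support := by simpa [hxv] using hx
    have hy' : y ∈ q.support := by simpa [hyv] using hy
    exact (hp.1.reachable_fiberGraph_start hq hx' hxw).symm.trans
      (hp.1.reachable_fiberGraph_start hq hy' hyw)

/-- A path of length at least two has an inner vertex next to its start. -/
theorem Walk.IsPath.exists_inner_adj_start {v w : V} {p : G.Walk v w} (hp : p.IsPath)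
    (hl : 2 ≤ p.length) : ∃ u ∈ p.support, u ≠ v ∧ u ≠ w ∧ G.Adj v u := by
  cases p with
  | nil => simp at hl
  | @cons _ b _ hadj q =>
    refine ⟨b, by simp, hadj.ne', ?_, hadj⟩
    rintro rfl
    rw [Walk.cons_isPath_iff, Walk.isPath_iff_nil,
      ← Walk.length_eq_zero_iff] at hp
    simp [hp.1] at hl

end SimpleGraph

/-! ### Minors of subdivisions from labels of branch vertices and edges -/

namespace Subdivision

variable {W U C : Type*} {H : SimpleGraph W} {K : SimpleGraph U} (s : Subdivision H K)
  (φ : W → C) (ψ : W → W → C)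

open Classical in
/-- The partial map that sends branch vertices to their image under `φ` and the inner vertices of
the path replacing `ab` to `ψ a b`. -/
noncomputable def label (u : U) : Option C :=
  if h : ∃ w, s.branch w = u then some (φ h.choose)
  else if h : ∃ a b, ∃ h : H.Adj a b, u ∈ (s.path h).support then
    some (ψ h.choose h.choose_spec.choose)
  else none

theorem label_branch (w : W) : s.label φ ψ (s.branch w) = some (φ w) := by
  have h : ∃ w', s.branch w' = s.branch w := ⟨w, rfl⟩
  rw [label, dif_pos h, s.branch_injective h.choose_spec]

variable {ψ}

/-- The choice made in `label` is harmless: paths sharing a non-branch vertex replace the same edge,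
so only its orientation is ambiguous, and `ψ` is symmetric. -/
theorem label_inner (hψ : ∀ a b, ψ a b = ψ b a) {a b : W} (hab : H.Adj a b) {u : U}
    (hu : u ∈ (s.path hab).support) (hn : u ∉ Set.range s.branch) :
    s.label φ ψ u = some (ψ a b) := by
  have h : ∃ a b, ∃ h : H.Adj a b, u ∈ (s.path h).support := ⟨a, b, hab, hu⟩
  rw [label, dif_neg (show ¬ ∃ w, s.branch w = u from hn), dif_pos h]
  have key : ∀ c d (hcd : H.Adj c d), u ∈ (s.path hcd).support → ψ c d = ψ a b := by
    intro c d hcd hu'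
    by_contra hne
    refine hn (s.independent hab hcd (fun he => hne ?_) u hu hu')
    rcases Sym2.eq_iff.1 he with ⟨rfl, rfl⟩ | ⟨rfl, rfl⟩
    · rfl
    · exact hψ _ _
  obtain ⟨hcd, hu'⟩ := h.choose_spec.choose_spec
  exact congrArg some (key _ _ hcd hu')

theorem notMem_range_branch {a b : W} (hab : H.Adj a b) {u : U}
    (hu : u ∈ (s.path hab).support) (ha : u ≠ s.branch a) (hb : u ≠ s.branch b) :
    u ∉ Set.range s.branch := by
  rintro ⟨w, rfl⟩
  rcases s.inner_new hab w hu with rfl | rfl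
  · exact ha rfl
  · exact hb rfl

theorem label_path (hψ : ∀ a b, ψ a b = ψ b a) {a b : W} (hab : H.Adj a b) {u : U}
    (hu : u ∈ (s.path hab).support) (ha : u ≠ s.branch a) (hb : u ≠ s.branch b) :
    s.label φ ψ u = some (ψ a b) :=
  s.label_inner φ hψ hab hu (s.notMem_range_branch hab hu ha hb)

theorem label_eq_some (hψ : ∀ a b, ψ a b = ψ b a) {u : U} {i : C}
    (hu : s.label φ ψ u = some i) :
    (∃ w, u = s.branch w ∧ φ w = i) ∨
      ∃ (a b : W) (hab : H.Adj a b), u ∈ (s.path hab).support ∧ u ≠ s.branch a ∧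
        u ≠ s.branch b ∧ ψ a b = i := by
  by_cases hr : u ∈ Set.range s.branch
  · obtain ⟨w, rfl⟩ := hr
    rw [label_branch, Option.some_inj] at hu
    exact Or.inl ⟨w, rfl, hu⟩
  · rcases s.cover_vertex u with h | ⟨a, b, hab, hu'⟩
    · exact absurd h hr
    · rw [s.label_inner φ hψ hab hu' hr, Option.some_inj] at hu
      exact Or.inr ⟨a, b, hab, hu', fun h => hr ⟨a, h.symm⟩, fun h => hr ⟨b, h.symm⟩, hu⟩

theorem mem_path_symm {a b : W} (hab : H.Adj a b) {u : U} (hu : u ∈ (s.path hab).support) :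
    u ∈ (s.path hab.symm).support := by
  rw [s.path_symm]
  simpa using hu

theorem length_path_symm {a b : W} (hab : H.Adj a b) :
    (s.path hab.symm).length = (s.path hab).length := by
  rw [s.path_symm, SimpleGraph.Walk.length_reverse]

theorem two_le_length_of_mem_subdividedEdges {a b : W} (h : s(a, b) ∈ s.subdividedEdges)
    (hab : H.Adj a b) : 2 ≤ (s.path hab).length := by
  obtain ⟨c, d, hcd, he, hl⟩ := h
  rcases Sym2.eq_iff.1 he with ⟨rfl, rfl⟩ | ⟨rfl, rfl⟩
  · exact hl
  · rwa [s.length_path_symm hcd]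

/-- Criterion for a subdivision `K` of `H` to have a minor `D`: branch vertices `w` are sent to
`φ w`, and the inner vertices of the path replacing `ab` to `ψ a b`. -/
theorem hasMinor {D : SimpleGraph C} (hψ : ∀ a b, ψ a b = ψ b a)
    (hinner : ∀ a b, H.Adj a b → ψ a b = φ a ∨ ψ a b = φ b ∨
      ((∀ w, φ w ≠ ψ a b) ∧ ∀ c d, H.Adj c d → ψ c d = ψ a b → s(c, d) = s(a, b)))
    (hbranch : ∀ a b, φ a = φ b → a ≠ b → H.Adj a b ∧ ψ a b = φ a)
    (hD : ∀ i j, D.Adj i j → ∃ a b, H.Adj a b ∧ (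
      (φ a = i ∧ φ b = j ∧ (ψ a b = i ∨ ψ a b = j)) ∨
      (φ a = i ∧ ψ a b = j ∧ s(a, b) ∈ s.subdividedEdges) ∨
      (φ a = j ∧ ψ a b = i ∧ s(a, b) ∈ s.subdividedEdges))) : K.HasMinor D := by
  set f := s.label φ ψ with hf
  have hstart : ∀ {a b : W} (hab : H.Adj a b) {u : U}, u ∈ (s.path hab).support →
      u ≠ s.branch a → u ≠ s.branch b → ψ a b = φ a →
      (K.fiberGraph f).Reachable u (s.branch a) := by
    intro a b hab u hu hua hub h
    refine ((s.isPath hab).reachable_fiberGraph_start (c := some (φ a)) (fun x hx hxb => ?_)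
      hu hub).symm
    by_cases hxa : x = s.branch a
    · rw [hxa, hf, label_branch]
    · rw [hf, s.label_path φ hψ hab hx hxa hxb, h]
  have hbr : ∀ a b, φ a = φ b → (K.fiberGraph f).Reachable (s.branch a) (s.branch b) := by
    intro a b hab
    by_cases hne : a = b
    · rw [hne]
    obtain ⟨hadj, h⟩ := hbranch a b hab hne
    refine (s.path hadj).reachable_fiberGraph (c := some (φ a)) fun x hx => ?_
    by_cases hxa : x = s.branch a
    · rw [hxa, hf, label_branch]
    by_cases hxb : x = s.branch b
    · rw [hxb, hf, label_branch, hab]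
    · rw [hf, s.label_path φ hψ hadj hx hxa hxb, h]
  -- Fibres are of two kinds: those where every vertex connects to a branch vertex, and those made
  -- of the inner vertices of a single path. Each is connected for its own reason, `hbr` or
  -- `reachable_fiberGraph_inner`.
  have hanchor : ∀ u i, f u = some i →
      (∃ w, φ w = i ∧ (K.fiberGraph f).Reachable u (s.branch w)) ∨
      ∃ (a b : W) (hab : H.Adj a b), u ∈ (s.path hab).support ∧ u ≠ s.branch a ∧
        u ≠ s.branch b ∧ ψ a b = i ∧ (∀ w, φ w ≠ i) ∧
        ∀ c d, H.Adj c d → ψ c d = i → s(c, d) = s(a, b) := by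
    intro u i hu
    rcases s.label_eq_some φ hψ hu with ⟨w, rfl, hw⟩ | ⟨a, b, hab, hu', hua, hub, rfl⟩
    · exact Or.inl ⟨w, hw, SimpleGraph.Reachable.refl _⟩
    rcases hinner a b hab with h | h | ⟨h1, h2⟩
    · exact Or.inl ⟨a, h.symm, hstart hab hu' hua hub h⟩
    · exact Or.inl ⟨b, h.symm, hstart hab.symm (s.mem_path_symm hab hu') hub hua
        ((hψ b a).trans h)⟩
    · exact Or.inr ⟨a, b, hab, hu', hua, hub, rfl, h1, h2⟩
  refine ⟨f, fun v w i hv hw => ?_, fun i j hij => ?_⟩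
  · rcases hanchor v i hv with ⟨x, hx, hvx⟩ | ⟨a, b, hab, hv', hva, hvb, hi, hn, hun⟩
    · rcases hanchor w i hw with ⟨y, hy, hwy⟩ | ⟨-, -, -, -, -, -, -, hn, -⟩
      · exact (hvx.trans (hbr x y (hx.trans hy.symm))).trans hwy.symm
      · exact absurd hx (hn x)
    · rcases hanchor w i hw with ⟨y, hy, -⟩ | ⟨c, d, hcd, hw', hwc, hwd, hi', -, -⟩
      · exact absurd hy (hn y)
      · have hw'' : w ∈ (s.path hab).support ∧ w ≠ s.branch a ∧ w ≠ s.branch b := by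
          rcases Sym2.eq_iff.1 (hun c d hcd hi') with ⟨rfl, rfl⟩ | ⟨rfl, rfl⟩
          · exact ⟨hw', hwc, hwd⟩
          · exact ⟨s.mem_path_symm hcd hw', hwd, hwc⟩
        exact (s.isPath hab).reachable_fiberGraph_inner (c := some i)
          (fun u hu hua hub => by rw [hf, s.label_path φ hψ hab hu hua hub, hi])
          hv' hva hvb hw''.1 hw''.2.1 hw''.2.2
  -- An edge of `D` comes either from a path whose two ends carry its labels, or from the first step
  -- of a subdivided path, between a branch vertex and an inner vertex.
  · have hsub : ∀ {a b : W} (h : H.Adj a b), s(a, b) ∈ s.subdividedEdges →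
        ∃ u, K.Adj (s.branch a) u ∧ f u = some (ψ a b) := fun {a b} h hl => by
      obtain ⟨u, hu, hua, hub, hadj⟩ := (s.isPath h).exists_inner_adj_start
        (s.two_le_length_of_mem_subdividedEdges hl h)
      exact ⟨u, hadj, s.label_path φ hψ h hu hua hub⟩
    obtain ⟨a, b, h, ⟨ha, hb, hab⟩ | ⟨ha, hab, hl⟩ | ⟨ha, hab, hl⟩⟩ := hD i j hij
    · refine (s.path h).exists_adj_fiber (fun he => hij.ne (Option.some_inj.1 he))
        (by rw [hf, label_branch, ha]) (by rw [hf, label_branch, hb]) fun u hu => ?_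
      by_cases hua : u = s.branch a
      · left
        rw [hua, hf, label_branch, ha]
      by_cases hub : u = s.branch b
      · right
        rw [hub, hf, label_branch, hb]
      rw [hf, s.label_path φ hψ h hu hua hub, Option.some_inj, Option.some_inj]
      exact hab
    · obtain ⟨u, hadj, hu⟩ := hsub h hl
      exact ⟨s.branch a, u, hadj, by rw [hf, label_branch, ha], hu.trans (by rw [hab])⟩
    · obtain ⟨u, hadj, hu⟩ := hsub h hl
      exact ⟨u, s.branch a, hadj.symm, hu.trans (by rw [hab]), by rw [hf, label_branch, ha]⟩

/-- Renaming the branch vertices of a subdivision along an automorphism. -/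
def reindex (σ : H ≃g H) : Subdivision H K where
  branch w := s.branch (σ w)
  branch_injective := s.branch_injective.comp σ.injective
  path h := s.path (σ.map_adj_iff.2 h)
  path_symm h := s.path_symm (σ.map_adj_iff.2 h)
  isPath h := s.isPath _
  inner_new h w hw := by
    simpa only [σ.injective.eq_iff] using s.inner_new (σ.map_adj_iff.2 h) (σ w) hw
  independent {a b c d} h h' hne u hu hu' := by
    have hne' : s(σ a, σ b) ≠ s(σ c, σ d) := fun he => hne (by
      rw [← Sym2.map_mk, ← Sym2.map_mk] at he
      exact Sym2.map.injective σ.injective he)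
    obtain ⟨w, rfl⟩ := s.independent _ _ hne' u hu hu'
    exact ⟨σ.symm w, by simp⟩
  cover_vertex u := by
    rcases s.cover_vertex u with ⟨w, rfl⟩ | ⟨a, b, h, hu⟩
    · exact Or.inl ⟨σ.symm w, by simp⟩
    · obtain ⟨a, rfl⟩ := σ.surjective a
      obtain ⟨b, rfl⟩ := σ.surjective b
      exact Or.inr ⟨a, b, σ.map_adj_iff.1 h, hu⟩
  cover_edge e he := by
    obtain ⟨a, b, h, hu⟩ := s.cover_edge e he
    obtain ⟨a, rfl⟩ := σ.surjective a
    obtain ⟨b, rfl⟩ := σ.surjective b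
    exact ⟨a, b, σ.map_adj_iff.1 h, hu⟩

end Subdivision

/-! ### The fan as a minor of the three families -/

instance : DecidableRel fanGraph5.Adj := fun a b =>
  decidable_of_iff (s(a, b) ∈ ({s(0, 1), s(1, 2), s(2, 3), s(4, 0), s(4, 1), s(4, 2), s(4, 3)} :
    Finset (Sym2 (Fin 5))) ∧ a ≠ b) (by simp [fanGraph5])

instance : DecidableRel graphCD6.Adj := fun a b =>
  decidable_of_iff (s(a, b) ∈ ({s(0, 2), s(2, 3), s(3, 5), s(5, 4), s(4, 1), s(1, 0), s(1, 2),
    s(3, 4)} : Finset (Sym2 (Fin 6))) ∧ a ≠ b) (by simp [graphCD6])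

namespace Subdivision

variable {U : Type*} {K : SimpleGraph U}

/-- Inner vertices may join either end; `max` is a symmetric way to choose one. -/
theorem hasMinor_fan (s : Subdivision fanGraph5 K) : K.HasMinor fanGraph5 :=
  s.hasMinor id (ψ := max) max_comm (by decide) (by decide) fun i j h =>
    ⟨i, j, h, Or.inl ⟨rfl, rfl, (max_choice i j)⟩⟩

/-- Contracting the edge `23` between the two triangles gives the hub; the other four vertices form
the path `0 - 1 - 4 - 5`. -/
theorem hasMinor_fan_of_CD6 (s : Subdivision graphCD6 K) : K.HasMinor fanGraph5 :=
  s.hasMinor ![0, 1, 4, 4, 2, 3] (ψ := fun a b => max (![0, 1, 4, 4, 2, 3] a)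
    (![0, 1, 4, 4, 2, 3] b)) (fun _ _ => max_comm _ _) (by decide) (by decide) fun i j h => by
      obtain ⟨a, b, hab, ha, hb⟩ : ∃ a b, graphCD6.Adj a b ∧
          (![0, 1, 4, 4, 2, 3] : Fin 6 → Fin 5) a = i ∧
          (![0, 1, 4, 4, 2, 3] : Fin 6 → Fin 5) b = j := by
        revert i j
        decide
      exact ⟨a, b, hab, Or.inl ⟨ha, hb, by rw [ha, hb]; exact max_choice i j⟩⟩

/-- Contracting the path for `03` gives the hub. The fan's path runs from the inner vertices of `01`
through branch vertices 1 and 2 to the inner vertices of `02`. -/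
theorem hasMinor_fan_of_adjacent (s : Subdivision (⊤ : SimpleGraph (Fin 4)) K)
    (h1 : s(0, 1) ∈ s.subdividedEdges) (h2 : s(0, 2) ∈ s.subdividedEdges) :
    K.HasMinor fanGraph5 := by
  let φ : Fin 4 → Fin 5 := ![4, 1, 2, 4]
  let ψ : Fin 4 → Fin 4 → Fin 5 := ![![4, 0, 3, 4], ![0, 4, 1, 4], ![3, 1, 4, 4], ![4, 4, 4, 4]]
  refine s.hasMinor φ (ψ := ψ) (by decide) (by decide) (by decide) fun i j hij => ?_
  have key : ∃ a b, (⊤ : SimpleGraph (Fin 4)).Adj a b ∧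
      ((φ a = i ∧ φ b = j ∧ (ψ a b = i ∨ ψ a b = j)) ∨
      (φ a = i ∧ ψ a b = j ∧ (s(a, b) = s(0, 1) ∨ s(a, b) = s(0, 2))) ∨
      (φ a = j ∧ ψ a b = i ∧ (s(a, b) = s(0, 1) ∨ s(a, b) = s(0, 2)))) := by
    revert i j
    decide
  have hsub : ∀ e, e = s(0, 1) ∨ e = s(0, 2) → e ∈ s.subdividedEdges := by
    rintro e (rfl | rfl) <;> assumption
  obtain ⟨a, b, hab, h⟩ := key
  exact ⟨a, b, hab, h.imp_right (Or.imp (fun h => ⟨h.1, h.2.1, hsub _ h.2.2⟩)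
    fun h => ⟨h.1, h.2.1, hsub _ h.2.2⟩)⟩

/-- Contracting the path for `02` gives the hub. The fan's path runs from the inner vertices of `01`
through branch vertices 1 and 3 to the inner vertices of `23`. -/
theorem hasMinor_fan_of_opposite (s : Subdivision (⊤ : SimpleGraph (Fin 4)) K)
    (h1 : s(0, 1) ∈ s.subdividedEdges) (h2 : s(2, 3) ∈ s.subdividedEdges) :
    K.HasMinor fanGraph5 := by
  let φ : Fin 4 → Fin 5 := ![4, 1, 4, 2]
  let ψ : Fin 4 → Fin 4 → Fin 5 := ![![4, 0, 4, 4], ![0, 4, 4, 1], ![4, 4, 4, 3], ![4, 1, 3, 4]]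
  refine s.hasMinor φ (ψ := ψ) (by decide) (by decide) (by decide) fun i j hij => ?_
  have key : ∃ a b, (⊤ : SimpleGraph (Fin 4)).Adj a b ∧
      ((φ a = i ∧ φ b = j ∧ (ψ a b = i ∨ ψ a b = j)) ∨
      (φ a = i ∧ ψ a b = j ∧ (s(a, b) = s(0, 1) ∨ s(a, b) = s(2, 3))) ∨
      (φ a = j ∧ ψ a b = i ∧ (s(a, b) = s(0, 1) ∨ s(a, b) = s(2, 3)))) := by
    revert i j
    decide
  have hsub : ∀ e, e = s(0, 1) ∨ e = s(2, 3) → e ∈ s.subdividedEdges := by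
    rintro e (rfl | rfl) <;> assumption
  obtain ⟨a, b, hab, h⟩ := key
  exact ⟨a, b, hab, h.imp_right (Or.imp (fun h => ⟨h.1, h.2.1, hsub _ h.2.2⟩)
    fun h => ⟨h.1, h.2.1, hsub _ h.2.2⟩)⟩

theorem mem_subdividedEdges_reindex {W : Type*} {H : SimpleGraph W} (s : Subdivision H K)
    (σ : H ≃g H) {a b : W} (h : s(σ a, σ b) ∈ s.subdividedEdges) (hab : H.Adj a b) :
    s(a, b) ∈ (s.reindex σ).subdividedEdges :=
  ⟨a, b, hab, rfl, s.two_le_length_of_mem_subdividedEdges h (σ.map_adj_iff.2 hab)⟩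

end Subdivision

/-- Two edges of `K₄` can be moved by a permutation of the vertices to `01` and `02` if they share
a vertex, and to `01` and `23` otherwise. -/
theorem exists_perm_edge_pair : ∀ a b c d : Fin 4, a ≠ b → c ≠ d → s(a, b) ≠ s(c, d) →
    ∃ σ : Equiv.Perm (Fin 4), s(σ 0, σ 1) = s(a, b) ∧
      (s(σ 0, σ 2) = s(c, d) ∨ s(σ 2, σ 3) = s(c, d)) := by
  have : ∀ a b c d : Fin 4, a ≠ b → c ≠ d → s(a, b) ≠ s(c, d) →
      ∃ x y z w : Fin 4, [x, y, z, w].Nodup ∧ s(x, y) = s(a, b) ∧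
        (s(x, z) = s(c, d) ∨ s(z, w) = s(c, d)) := by
    decide
  intro a b c d hab hcd hne
  obtain ⟨x, y, z, w, hnd, h⟩ := this a b c d hab hcd hne
  have hinj : Function.Injective ![x, y, z, w] := by
    rw [← List.nodup_ofFn]
    simpa using hnd
  exact ⟨Equiv.ofBijective _ (Finite.injective_iff_bijective.1 hinj), h⟩

/-- A subdivision of `K₄` with at least two subdivided edges has the fan `F₅` as a minor. -/
theorem Subdivision.hasMinor_fan_of_K4 {U : Type*} {K : SimpleGraph U}
    (s : Subdivision (⊤ : SimpleGraph (Fin 4)) K) (h : 2 ≤ s.subdividedEdges.ncard) :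
    K.HasMinor fanGraph5 := by
  obtain ⟨e, he, e', he', hne⟩ := (Set.one_lt_ncard).1 h
  obtain ⟨a, b, hab, rfl, -⟩ := id he
  obtain ⟨c, d, hcd, rfl, -⟩ := id he'
  obtain ⟨σ, h1, h2⟩ := exists_perm_edge_pair a b c d hab.ne hcd.ne hne
  let τ : (⊤ : SimpleGraph (Fin 4)) ≃g (⊤ : SimpleGraph (Fin 4)) :=
    ⟨σ, by simp⟩
  have h01 : s(0, 1) ∈ (s.reindex τ).subdividedEdges :=
    s.mem_subdividedEdges_reindex τ (h1 ▸ he) (by simp)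
  rcases h2 with h2 | h2
  · exact (s.reindex τ).hasMinor_fan_of_adjacent h01
      (s.mem_subdividedEdges_reindex τ (h2 ▸ he') (by simp))
  · exact (s.reindex τ).hasMinor_fan_of_opposite h01
      (s.mem_subdividedEdges_reindex τ (h2 ▸ he') (by simp))

theorem mainTheorem2 {V : Type*} [Fintype V] (G : SimpleGraph V) (hG : IsSPNGraph G) :
    (¬ ∃ S : G.Subgraph, IsSubdivision fanGraph5 S.coe) ∧
    (¬ ∃ S : G.Subgraph, IsSubdivision graphCD6 S.coe) ∧
    (¬ ∃ (S : G.Subgraph) (s : Subdivision (⊤ : SimpleGraph (Fin 4)) S.coe),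
      2 ≤ s.subdividedEdges.ncard ∧ s.subdividedEdges.ncard ≤ 5) := by
  refine ⟨?_, ?_, ?_⟩
  · rintro ⟨S, ⟨s⟩⟩
    exact not_isSPNGraph_of_hasMinor_fan s.hasMinor_fan.of_coe hG
  · rintro ⟨S, ⟨s⟩⟩
    exact not_isSPNGraph_of_hasMinor_fan s.hasMinor_fan_of_CD6.of_coe hG
  · rintro ⟨S, s, h, -⟩
    exact not_isSPNGraph_of_hasMinor_fan (s.hasMinor_fan_of_K4 h).of_coe hG
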